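/- Let $d\ge 1$, $s\ge 0$ and $q$ be integers and let $p$ be a real number with $p>2$ and $q<p<2q$. Let $\Omega=[0,1]^d$, and let $W^{s,p}(\Omega)$ be the Sobolev space of all $f\in L^p(\Omega)$ whose weak derivatives $D^\alpha f$, $|\alpha|\le s$, exist and lie in $L^p(\Omega)$, with norm $\|f\|_{W^{s,p}(\Omega)}=\sum_{|\alpha|\le s}\|D^\alpha f\|_{L^p(\Omega)}$. For $f\in W^{s,p}(\Omega)$ put $I_f^q=\int_\Omega f(x)^q\,dx$. Let $R\in(0,\infty]$. Then there is a constant $c>0$, depending only on $d,s,p,q,R$, such that for every $n\ge 1$ $$\inf_{\hat H}\ \sup_{f\in W^{s,p}(\Omega),\ \|f\|_{W^{s,p}(\Omega)}\le R}\ \mathbb E\Big[\big|\hat H\big(x_1,\dots,x_n,f(x_1),\dots,f(x_n)\big)-I_f^q\big|\Big]\ \ge\ c\,n^{\max\{-q(s/d-1/p)-1,\ -1/2-s/d\}},$$ where $x_1,\dots,x_n$ are independent and uniformly distributed on $\Omega$ and the infimum is over all measurable functions $\hat H:\Omega^n\times\mathbb R^n\to\mathbb R$. For $R=\infty$ the supremum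 is over the whole space $W^{s,p}(\Omega)$. -/

import Mathlib

open MeasureTheory Set
open scoped ENNReal ContDiff

noncomputable section

/-- The closed unit cube `Ω = [0,1]^d`. -/
def unitCube (d : ℕ) : Set (Fin d → ℝ) := Set.Icc 0 1

/-- The uniform distribution on `Ω = [0,1]^d`: Lebesgue measure restricted to the cube
(which has volume one). -/
def uniformCube (d : ℕ) : Measure (Fin d → ℝ) := volume.restrict (unitCube d)

instance (d : ℕ) : IsProbabilityMeasure (uniformCube d) := by
  constructor
  rw [uniformCube, Measure.restrict_apply_univ, unitCube, Real.volume_Icc_pi]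
  simp

/-- The partial derivative `∂φ/∂x_i`. -/
def partialDeriv {d : ℕ} (i : Fin d) (φ : (Fin d → ℝ) → ℝ) : (Fin d → ℝ) → ℝ :=
  fun x => fderiv ℝ φ x (Pi.single i 1)

/-- The classical derivative `D^α φ = ∂_1^{α_1} ⋯ ∂_d^{α_d} φ` for a multi-index `α`
(used for smooth `φ` only). -/
def multiDeriv {d : ℕ} (α : Fin d → ℕ) (φ : (Fin d → ℝ) → ℝ) : (Fin d → ℝ) → ℝ :=
  (List.finRange d).foldr (fun i ψ => (partialDeriv i)^[α i] ψ) φ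

/-- `g` is the weak derivative `D^α f` in the interior of the unit cube: both functions are locally
integrable there and `∫_Ω f D^α φ = (-1)^{|α|} ∫_Ω g φ` for every smooth `φ` with compact support
in the interior of the cube. -/
def IsWeakDeriv {d : ℕ} (α : Fin d → ℕ) (f g : (Fin d → ℝ) → ℝ) : Prop :=
  LocallyIntegrableOn f (interior (unitCube d)) ∧
  LocallyIntegrableOn g (interior (unitCube d)) ∧
  ∀ φ : (Fin d → ℝ) → ℝ, ContDiff ℝ ∞ φ → HasCompactSupport φ →
    tsupport φ ⊆ interior (unitCube d) →
    ∫ x in unitCube d, f x * multiDeriv α φ x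
      = (-1) ^ (∑ i, α i) * ∫ x in unitCube d, g x * φ x

/-- The finite set of multi-indices `α ∈ ℕ₀^d` with `|α| ≤ s`. -/
def multiIndices (d s : ℕ) : Finset (Fin d → ℕ) :=
  (Fintype.piFinset fun _ : Fin d => Finset.range (s + 1)).filter fun α => ∑ i, α i ≤ s

theorem mem_multiIndices {d s : ℕ} {α : Fin d → ℕ} :
    α ∈ multiIndices d s ↔ ∑ i, α i ≤ s := by
  simp only [multiIndices, Finset.mem_filter, Fintype.mem_piFinset, Finset.mem_range,
    and_iff_right_iff_imp]
  intro h i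
  exact Nat.lt_succ_of_le ((Finset.single_le_sum (fun _ _ => Nat.zero_le _)
    (Finset.mem_univ i)).trans h)

/-- Membership of (a representative of) `f` in the Sobolev space `W^{s,p}(Ω)`: `f ∈ L^p(Ω)`, and for
every `|α| ≤ s` the weak derivative `D^α f` exists and lies in `L^p(Ω)`. -/
def MemSobolev {d : ℕ} (s : ℕ) (p : ℝ≥0∞) (f : (Fin d → ℝ) → ℝ) : Prop :=
  MemLp f p (uniformCube d) ∧
  ∀ α : Fin d → ℕ, ∑ i, α i ≤ s → ∃ g, IsWeakDeriv α f g ∧ MemLp g p (uniformCube d)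

/-- `‖D^α f‖_{L^p(Ω)}`. Weak derivatives are unique up to null sets, so all members of the family
over which the infimum is taken have the same norm; the value is `∞` if there is no weak
derivative. -/
def weakDerivNorm {d : ℕ} (α : Fin d → ℕ) (p : ℝ≥0∞) (f : (Fin d → ℝ) → ℝ) : ℝ≥0∞ :=
  ⨅ (g : (Fin d → ℝ) → ℝ) (_ : IsWeakDeriv α f g), eLpNorm g p (uniformCube d)

/-- The Sobolev norm `∑_{|α| ≤ s} ‖D^α f‖_{L^p(Ω)}`. -/
def sobolevNorm {d : ℕ} (s : ℕ) (p : ℝ≥0∞) (f : (Fin d → ℝ) → ℝ) : ℝ≥0∞ :=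
  ∑ α ∈ multiIndices d s, weakDerivNorm α p f

/-- The closed ball of radius `R ∈ [0,∞]` around zero in `W^{s,p}(Ω)`; for `R = ∞` this is the whole
space `W^{s,p}(Ω)`. -/
def sobolevBall (d s : ℕ) (p R : ℝ≥0∞) : Set ((Fin d → ℝ) → ℝ) :=
  {f | MemSobolev s p f ∧ sobolevNorm s p f ≤ R}

/-- The `q`-th moment `I_f^q = ∫_Ω f^q`. -/
def moment {d : ℕ} (q : ℕ) (f : (Fin d → ℝ) → ℝ) : ℝ :=
  ∫ x, f x ^ q ∂(uniformCube d)

/-- The expected error `E |H((x_i), (f(x_i))) - I_f^q|`, where `x_1, …, x_n` are independent and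
uniformly distributed on the unit cube. -/
def expectedError {d n : ℕ} (q : ℕ) (H : (Fin n → Fin d → ℝ) → (Fin n → ℝ) → ℝ)
    (f : (Fin d → ℝ) → ℝ) : ℝ≥0∞ :=
  ∫⁻ x, ENNReal.ofReal |H x (fun i => f (x i)) - moment q f|
    ∂(Measure.pi fun _ : Fin n => uniformCube d)

/-- The minimax expected error over the class `F`: the infimum over all (measurable) estimators,
which see the `n` points and the `n` exact function values, of the worst-case expected error. -/
def minimaxError (d n q : ℕ) (F : Set ((Fin d → ℝ) → ℝ)) : ℝ≥0∞ :=
  ⨅ (H : (Fin n → Fin d → ℝ) → (Fin n → ℝ) → ℝ) (_ : Measurable (Function.uncurry H)),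
    ⨆ f ∈ F, expectedError q H f

end

/-!
An estimator cannot distinguish two functions that agree at the sample points. Hence, if for every
sample some permutation of a finite test family changes none of the observed values, then the
average error over the family is at least half the average change of the `q`-th moment under the
permutation. Divide the cube into `m ^ d ≥ 2 n` equal cells, each of which carries a rescaled smooth
bump. At least half of the cells contain no sample point.

* For a test family of single bumps, of height of order `m ^ (-s + d / p)`, and the zero function,
  the permutation exchanges every unseen bump with zero. The moment changes by the order of
  `m ^ (-q * (s - d / p) - d)`, which gives the exponent `-q * (s / d - 1 / p) - 1`.
* For a positive constant perturbed by bumps of height of order `m ^ (-s)` with all choices of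
  signs, the permutation flips the unseen signs. The moment changes by a Rademacher sum of at least
  `m ^ d / 2` terms of order `m ^ (-s - d)`, which by Khintchine is on average of the order of
  `m ^ (-s - d / 2)`. This gives the exponent `-1 / 2 - s / d`.
-/

open scoped BigOperators Function

section Rademacher

variable {ι : Type*}

/-- The Rademacher sum `∑_{k ∈ t} ±a_k` for the choice of signs `ε`. -/
def rademacherSum (a : ι → ℝ) (t : Finset ι) (ε : ι → ℤˣ) : ℝ := ∑ k ∈ t, a k * (ε k : ℤ)

variable [Fintype ι] [DecidableEq ι]

theorem expect_comp_rademacherSum_insert (F : ℝ → ℝ) (a : ι → ℝ) {j : ι} {t : Finset ι}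
    (hj : j ∉ t) :
    𝔼 ε, F (rademacherSum a (insert j t) ε) =
      𝔼 ε, (F (rademacherSum a t ε + a j) + F (rademacherSum a t ε - a j)) / 2 := by
  let flip : Equiv.Perm (ι → ℤˣ) := Equiv.mulLeft (Pi.mulSingle j (-1))
  have hflip : 𝔼 ε, F (rademacherSum a (insert j t) (flip ε)) =
      𝔼 ε, F (rademacherSum a (insert j t) ε) :=
    Fintype.expect_equiv flip _ _ fun _ => rfl
  have hrest : ∀ ε, rademacherSum a t (flip ε) = rademacherSum a t ε := fun ε =>
    Finset.sum_congr rfl fun k hk => by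
      simp [flip, Pi.mulSingle_eq_of_ne (ne_of_mem_of_not_mem hk hj)]
  have hinsert : ∀ ε, rademacherSum a (insert j t) ε = a j * (ε j : ℤ) + rademacherSum a t ε :=
    fun ε => Finset.sum_insert hj
  calc 𝔼 ε, F (rademacherSum a (insert j t) ε)
      = 𝔼 ε, (F (rademacherSum a (insert j t) ε)
          + F (rademacherSum a (insert j t) (flip ε))) / 2 := by
        rw [← Finset.expect_div, Finset.expect_add_distrib, hflip, add_self_div_two]
    _ = _ := by
        refine Finset.expect_congr rfl fun ε _ => ?_
        rw [hinsert, hinsert, hrest]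
        rcases Int.units_eq_one_or (ε j) with h | h <;>
          simp [flip, h, add_comm, sub_eq_add_neg]

theorem expect_rademacherSum_sq (a : ι → ℝ) (t : Finset ι) :
    𝔼 ε, rademacherSum a t ε ^ 2 = ∑ k ∈ t, a k ^ 2 := by
  induction t using Finset.induction_on with
  | empty => simp [rademacherSum]
  | insert j t hj ih =>
    have hsq : ∀ S : ℝ, ((S + a j) ^ 2 + (S - a j) ^ 2) / 2 = a j ^ 2 + S ^ 2 := fun S => by ring
    rw [expect_comp_rademacherSum_insert (· ^ 2) a hj, Finset.sum_insert hj, ← ih]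
    simp only [hsq, Finset.expect_add_distrib, Fintype.expect_const]

theorem expect_rademacherSum_pow_four_le (a : ι → ℝ) (t : Finset ι) :
    𝔼 ε, rademacherSum a t ε ^ 4 ≤ 3 * (∑ k ∈ t, a k ^ 2) ^ 2 := by
  induction t using Finset.induction_on with
  | empty => simp [rademacherSum]
  | insert j t hj ih =>
    have hpow : ∀ S : ℝ, ((S + a j) ^ 4 + (S - a j) ^ 4) / 2
        = S ^ 4 + 6 * a j ^ 2 * S ^ 2 + a j ^ 4 := fun S => by ring
    rw [expect_comp_rademacherSum_insert (· ^ 4) a hj, Finset.sum_insert hj]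
    simp only [hpow, Finset.expect_add_distrib, ← Finset.mul_expect, expect_rademacherSum_sq,
      Fintype.expect_const]
    nlinarith [ih, sq_nonneg (a j ^ 2)]

theorem sq_div_sub_pow_four_div_le_abs {σ : ℝ} (hσ : 0 < σ) (S : ℝ) :
    S ^ 2 / (2 * σ) - S ^ 4 / (8 * σ ^ 3) ≤ |S| := by
  have hS := abs_nonneg S
  have hcubic : 0 ≤ |S| ^ 3 - 4 * σ ^ 2 * |S| + 8 * σ ^ 3 := by
    nlinarith [mul_nonneg (sq_nonneg (|S| - 4 / 3 * σ)) (by positivity : 0 ≤ |S| + 8 / 3 * σ),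
      mul_nonneg (sq_nonneg σ) hS, pow_pos hσ 3]
  have hdiff : |S| - (S ^ 2 / (2 * σ) - S ^ 4 / (8 * σ ^ 3)) =
      |S| * (|S| ^ 3 - 4 * σ ^ 2 * |S| + 8 * σ ^ 3) / (8 * σ ^ 3) := by
    rw [← sq_abs S, ← Even.pow_abs (by decide : Even 4) S]
    field_simp
    ring
  exact sub_nonneg.1 (hdiff ▸ by positivity)

/-- Khintchine's inequality: the fourth moment controls how much of the second
moment comes from large values of the sum. -/
theorem sqrt_sum_sq_le_expect_abs_rademacherSum (a : ι → ℝ) (t : Finset ι) :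
    √(∑ k ∈ t, a k ^ 2) / 8 ≤ 𝔼 ε, |rademacherSum a t ε| := by
  set σ := √(∑ k ∈ t, a k ^ 2)
  have hσ : σ ^ 2 = ∑ k ∈ t, a k ^ 2 := Real.sq_sqrt (Finset.sum_nonneg fun k _ => sq_nonneg _)
  obtain h0 | h0 : 0 = σ ∨ 0 < σ := (Real.sqrt_nonneg _).eq_or_lt
  · rw [← h0, zero_div]
    exact Finset.expect_nonneg fun _ _ => abs_nonneg _
  calc σ / 8 = σ ^ 2 / (2 * σ) - 3 * (σ ^ 2) ^ 2 / (8 * σ ^ 3) := by field_simp; norm_num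
    _ ≤ (𝔼 ε, rademacherSum a t ε ^ 2) / (2 * σ)
          - (𝔼 ε, rademacherSum a t ε ^ 4) / (8 * σ ^ 3) := by
        rw [expect_rademacherSum_sq, hσ]
        gcongr
        exact expect_rademacherSum_pow_four_le a t
    _ = 𝔼 ε, (rademacherSum a t ε ^ 2 / (2 * σ) - rademacherSum a t ε ^ 4 / (8 * σ ^ 3)) := by
        rw [Finset.expect_sub_distrib, Finset.expect_div, Finset.expect_div]
    _ ≤ 𝔼 ε, |rademacherSum a t ε| :=
        Finset.expect_le_expect fun ε _ => sq_div_sub_pow_four_div_le_abs h0 _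

end Rademacher

section LowerBound

variable {ι : Type*} [Fintype ι]

theorem expect_abs_sub_comp_perm_le (τ : Equiv.Perm ι) {h I : ι → ℝ} (hτ : ∀ i, h (τ i) = h i) :
    𝔼 i, |I i - I (τ i)| ≤ 2 * 𝔼 i, |h i - I i| := by
  have hpt : ∀ i, |I i - I (τ i)| ≤ |h i - I i| + |h (τ i) - I (τ i)| := fun i => by
    rw [hτ, abs_sub_comm (h i) (I i)]
    exact abs_sub_le _ _ _
  calc 𝔼 i, |I i - I (τ i)|
      ≤ 𝔼 i, (|h i - I i| + |h (τ i) - I (τ i)|) := Finset.expect_le_expect fun i _ => hpt i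
    _ = 2 * 𝔼 i, |h i - I i| := by
        rw [Finset.expect_add_distrib, Fintype.expect_equiv τ (fun i => |h (τ i) - I (τ i)|)
          (fun i => |h i - I i|) fun _ => rfl, two_mul]

theorem card_div_card_mul_le_expect {g : ι → ℝ} (hg : ∀ i, 0 ≤ g i) {S : Finset ι} {c : ℝ}
    (hS : ∀ i ∈ S, c ≤ g i) : S.card / Fintype.card ι * c ≤ 𝔼 i, g i := by
  rw [Fintype.expect_eq_sum_div_card, div_mul_eq_mul_div]
  gcongr
  calc S.card * c = S.card • c := (nsmul_eq_mul _ _).symm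
    _ ≤ ∑ i ∈ S, g i := Finset.card_nsmul_le_sum _ _ _ hS
    _ ≤ ∑ i, g i := Finset.sum_le_univ_sum_of_nonneg hg

variable [Nonempty ι] {d n q : ℕ} {F : Set ((Fin d → ℝ) → ℝ)} {f : ι → (Fin d → ℝ) → ℝ} {L : ℝ}

theorem le_minimaxError_of_le_expect (hf : ∀ i, f i ∈ F) (hm : ∀ i, Measurable (f i))
    (h : ∀ (H : (Fin n → ℝ) → ℝ) (x : Fin n → Fin d → ℝ),
      L ≤ 𝔼 i, |H (fun j => f i (x j)) - moment q (f i)|) :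
    ENNReal.ofReal L ≤ minimaxError d n q F := by
  refine le_iInf₂ fun H hH => ?_
  set B := ⨆ g ∈ F, expectedError q H g
  have hmeas : ∀ i, Measurable fun x : Fin n → Fin d → ℝ =>
      ENNReal.ofReal |H x (fun j => f i (x j)) - moment q (f i)| := fun i => by
    have hsample : Measurable fun (x : Fin n → Fin d → ℝ) j => f i (x j) :=
      measurable_pi_lambda _ fun j => (hm i).comp (measurable_pi_apply j)
    exact ((hH.comp (measurable_id.prodMk hsample)).sub_const _).norm.ennreal_ofReal
  have hsum : Fintype.card ι * ENNReal.ofReal L ≤ Fintype.card ι * B :=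
    calc Fintype.card ι * ENNReal.ofReal L
        = ∫⁻ _, ENNReal.ofReal (Fintype.card ι * L)
            ∂(Measure.pi fun _ : Fin n => uniformCube d) := by
          rw [lintegral_const, measure_univ, mul_one, ENNReal.ofReal_mul (Nat.cast_nonneg _),
            ENNReal.ofReal_natCast]
      _ ≤ ∫⁻ x, ∑ i, ENNReal.ofReal |H x (fun j => f i (x j)) - moment q (f i)|
            ∂(Measure.pi fun _ : Fin n => uniformCube d) := by
          refine lintegral_mono fun x => ?_
          rw [← ENNReal.ofReal_sum_of_nonneg fun i _ => abs_nonneg _,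
            ← Fintype.card_mul_expect]
          gcongr
          exact h (H x) x
      _ = ∑ i, expectedError q H (f i) := lintegral_finsetSum _ fun i _ => hmeas i
      _ ≤ ∑ _ : ι, B := Finset.sum_le_sum fun i _ => le_iSup₂_of_le (f i) (hf i) le_rfl
      _ = Fintype.card ι * B := by simp
  exact (ENNReal.mul_le_mul_iff_right (by simp) (by simp)).1 hsum

/-- An averaged two-point method: `τ` exchanges functions which look alike at the sample points. -/
theorem le_minimaxError_of_perm (hf : ∀ i, f i ∈ F) (hm : ∀ i, Measurable (f i))
    (h : ∀ x : Fin n → Fin d → ℝ, ∃ τ : Equiv.Perm ι, (∀ i j, f (τ i) (x j) = f i (x j)) ∧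
      2 * L ≤ 𝔼 i, |moment q (f i) - moment q (f (τ i))|) :
    ENNReal.ofReal L ≤ minimaxError d n q F := by
  refine le_minimaxError_of_le_expect hf hm fun H x => ?_
  obtain ⟨τ, hτ, hL⟩ := h x
  have hperm := expect_abs_sub_comp_perm_le τ (h := fun i => H fun j => f i (x j))
    (I := fun i => moment q (f i)) fun i => congrArg H (funext (hτ i))
  linarith

end LowerBound

section DisjointSupports

variable {ι X M : Type*} [Zero M] {ψ : ι → X → M}

theorem exists_forall_ne_eq_zero [Nonempty ι]
    (hψ : Pairwise (Disjoint on fun k => Function.support (ψ k))) (x : X) :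
    ∃ k, ∀ l ≠ k, ψ l x = 0 := by
  by_cases h : ∃ k, ψ k x ≠ 0
  · obtain ⟨k, hk⟩ := h
    exact ⟨k, fun l hl => not_not.1 fun hlx => (hψ hl).le_bot ⟨hlx, hk⟩⟩
  · push Not at h
    exact ⟨Classical.arbitrary ι, fun l _ => h l⟩

theorem exists_card_div_two_le_card_unseen [Fintype ι]
    (hψ : Pairwise (Disjoint on fun k => Function.support (ψ k))) {n : ℕ}
    (hn : 2 * n ≤ Fintype.card ι) (x : Fin n → X) :
    ∃ U : Finset ι, (∀ k ∈ U, ∀ j, ψ k (x j) = 0) ∧ (Fintype.card ι : ℝ) / 2 ≤ U.card := by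
  classical
  let seen : Finset ι := Finset.univ.biUnion fun j => {k | ψ k (x j) ≠ 0}
  have hseen : seen.card ≤ n := by
    have hone : ∀ j, (Finset.univ.filter fun k => ψ k (x j) ≠ 0).card ≤ 1 := fun j => by
      simp only [Finset.card_le_one, Finset.mem_filter, Finset.mem_univ, true_and]
      exact fun k hk l hl => hψ.eq (not_disjoint_iff.2 ⟨x j, hk, hl⟩)
    simpa using Finset.card_biUnion_le_card_mul Finset.univ _ 1 fun j _ => hone j
  refine ⟨seenᶜ, fun k hk j => ?_, ?_⟩
  · by_contra h
    exact Finset.mem_compl.1 hk (Finset.mem_biUnion.2 ⟨j, Finset.mem_univ j, by simpa using h⟩)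
  · have hhalf : Fintype.card ι ≤ seenᶜ.card * 2 := by
      have := Finset.card_add_card_compl seen
      omega
    rw [div_le_iff₀ two_pos]
    exact_mod_cast hhalf

end DisjointSupports

theorem two_mul_pow_pred_mul_le_pow_sub_pow {a u : ℝ} {q : ℕ} (hq : q ≠ 0) (hu : 0 ≤ u)
    (hua : u ≤ a) : 2 * a ^ (q - 1) * u ≤ (a + u) ^ q - (a - u) ^ q := by
  obtain ⟨r, rfl⟩ := Nat.exists_eq_succ_of_ne_zero hq
  have ha : 0 ≤ a := hu.trans hua
  have hau : 0 ≤ a - u := sub_nonneg.2 hua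
  have hplus : (a + u) * a ^ r ≤ (a + u) ^ (r + 1) := by
    rw [pow_succ']
    gcongr
    exact le_add_of_nonneg_right hu
  have hminus : (a - u) ^ (r + 1) ≤ (a - u) * a ^ r := by
    rw [pow_succ']
    exact mul_le_mul_of_nonneg_left (pow_le_pow_left₀ hau (sub_le_self _ hu) r) hau
  rw [Nat.succ_eq_add_one, Nat.add_sub_cancel]
  linarith

theorem integrable_uniformCube {d : ℕ} {f : (Fin d → ℝ) → ℝ} (hf : Continuous f) :
    Integrable f (uniformCube d) :=
  hf.continuousOn.integrableOn_compact isCompact_Icc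

section BumpFamily

variable {ι : Type*} {d : ℕ}

/-- A family of bumps with values in `[0, 1]` and disjoint supports, each of which equals `1` on a
part of the cube of measure at least `v`. -/
structure IsBumpFamily (ψ : ι → (Fin d → ℝ) → ℝ) (v : ℝ) : Prop where
  continuous (k : ι) : Continuous (ψ k)
  nonneg (k : ι) (x : Fin d → ℝ) : 0 ≤ ψ k x
  le_one (k : ι) (x : Fin d → ℝ) : ψ k x ≤ 1
  disjoint : Pairwise (Disjoint on fun k => Function.support (ψ k))
  le_measure (k : ι) : v ≤ (uniformCube d).real {x | ψ k x = 1}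

/-- The constant `a` perturbed by the bumps `ψ` with heights `θ`. -/
def bumpSum [Fintype ι] (ψ : ι → (Fin d → ℝ) → ℝ) (a : ℝ) (θ : ι → ℝ) (x : Fin d → ℝ) : ℝ :=
  a + ∑ k, θ k * ψ k x

/-- The sign vector which flips the signs at the indices in `U`, for use by multiplication. -/
def flipSigns [DecidableEq ι] (U : Finset ι) (k : ι) : ℤˣ := if k ∈ U then -1 else 1

namespace IsBumpFamily

variable {ψ : ι → (Fin d → ℝ) → ℝ} {v : ℝ}

theorem le_integral_pow (hψ : IsBumpFamily ψ v) (q : ℕ) (k : ι) :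
    v ≤ ∫ x, ψ k x ^ q ∂(uniformCube d) :=
  calc v ≤ (uniformCube d).real {x | ψ k x = 1} := hψ.le_measure k
    _ ≤ (uniformCube d).real {x | 1 ≤ ψ k x ^ q} :=
        measureReal_mono fun x (hx : ψ k x = 1) => by simp [hx]
    _ ≤ ∫ x, ψ k x ^ q ∂(uniformCube d) := by
        simpa using mul_meas_ge_le_integral_of_nonneg
          (.of_forall fun x => pow_nonneg (hψ.nonneg k x) q)
          (integrable_uniformCube ((hψ.continuous k).pow q)) 1

theorem le_moment_const_mul (hψ : IsBumpFamily ψ v) (q : ℕ) {b : ℝ} (hb : 0 ≤ b) (k : ι) :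
    b ^ q * v ≤ moment q fun x => b * ψ k x := by
  simp only [moment, mul_pow, integral_const_mul]
  exact mul_le_mul_of_nonneg_left (hψ.le_integral_pow q k) (pow_nonneg hb q)

theorem le_moment_sub_moment (hψ : IsBumpFamily ψ v) {q : ℕ} (hq : q ≠ 0) {a b : ℝ} (hb : 0 ≤ b)
    (hba : b ≤ a) (k : ι) :
    2 * a ^ (q - 1) * b * v ≤
      moment q (fun x => a + b * ψ k x) - moment q (fun x => a + -b * ψ k x) := by
  have hc := hψ.continuous k
  have ha : 0 ≤ a := hb.trans hba
  calc 2 * a ^ (q - 1) * b * v ≤ 2 * a ^ (q - 1) * b * ∫ x, ψ k x ^ 1 ∂(uniformCube d) := by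
        gcongr
        exact hψ.le_integral_pow 1 k
    _ = ∫ x, 2 * a ^ (q - 1) * (b * ψ k x) ∂(uniformCube d) := by
        rw [← integral_const_mul]
        simp only [pow_one, mul_assoc]
    _ ≤ ∫ x, ((a + b * ψ k x) ^ q - (a + -b * ψ k x) ^ q) ∂(uniformCube d) := by
        refine integral_mono (integrable_uniformCube (by fun_prop))
          (integrable_uniformCube (by fun_prop)) fun x => ?_
        simp only [neg_mul, ← sub_eq_add_neg]
        exact two_mul_pow_pred_mul_le_pow_sub_pow hq (mul_nonneg hb (hψ.nonneg k x))
          ((mul_le_of_le_one_right hb (hψ.le_one k x)).trans hba)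
    _ = _ := integral_sub (integrable_uniformCube (by fun_prop))
        (integrable_uniformCube (by fun_prop))

variable [Fintype ι]

theorem continuous_bumpSum (hψ : IsBumpFamily ψ v) (a : ℝ) (θ : ι → ℝ) :
    Continuous (bumpSum ψ a θ) :=
  continuous_const.add (continuous_finsetSum _ fun k _ => continuous_const.mul (hψ.continuous k))

variable [Nonempty ι]

theorem moment_bumpSum (hψ : IsBumpFamily ψ v) (q : ℕ) (a : ℝ) (θ : ι → ℝ) :
    moment q (bumpSum ψ a θ) = a ^ q + ∑ k, (moment q (fun x => a + θ k * ψ k x) - a ^ q) := by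
  have hpt : ∀ x, bumpSum ψ a θ x ^ q = a ^ q + ∑ k, ((a + θ k * ψ k x) ^ q - a ^ q) := fun x => by
    obtain ⟨k, hk⟩ := exists_forall_ne_eq_zero hψ.disjoint x
    rw [bumpSum, Fintype.sum_eq_single k fun l hl => by rw [hk l hl, mul_zero],
      Fintype.sum_eq_single k fun l hl => by rw [hk l hl, mul_zero, add_zero, sub_self],
      add_sub_cancel]
  have hint : ∀ k, Integrable (fun x => (a + θ k * ψ k x) ^ q) (uniformCube d) := fun k =>
    integrable_uniformCube (by have := hψ.continuous k; fun_prop)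
  have hint' : ∀ k, Integrable (fun x => (a + θ k * ψ k x) ^ q - a ^ q) (uniformCube d) :=
    fun k => (hint k).sub (integrable_const _)
  simp only [moment, hpt]
  rw [integral_add (integrable_const _) (integrable_finsetSum _ fun k _ => hint' k),
    integral_finsetSum _ fun k _ => hint' k]
  simp [integral_sub (hint _) (integrable_const _)]

variable {n q : ℕ} {F : Set ((Fin d → ℝ) → ℝ)}

theorem le_minimaxError_of_spikes (hψ : IsBumpFamily ψ v) (hv : 0 ≤ v)
    (hn : 2 * n ≤ Fintype.card ι) (hq : q ≠ 0) {b : ℝ} (hb : 0 ≤ b)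
    (hF : ∀ k, ∀ t ∈ Icc 0 b, (fun x => t * ψ k x) ∈ F) :
    ENNReal.ofReal (b ^ q * v / 4) ≤ minimaxError d n q F := by
  classical
  let f : ι × Bool → (Fin d → ℝ) → ℝ := fun i x => cond i.2 b 0 * ψ i.1 x
  refine le_minimaxError_of_perm (f := f) (fun i => hF _ _ ?_)
    (fun i => ((hψ.continuous i.1).const_mul _).measurable) fun x => ?_
  · cases i.2 <;> simp [hb]
  obtain ⟨U, hU, hcard⟩ := exists_card_div_two_le_card_unseen hψ.disjoint hn x
  let τ : Equiv.Perm (ι × Bool) :=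
    Equiv.prodCongrRight fun k => if k ∈ U then Equiv.boolNot else 1
  refine ⟨τ, fun i j => ?_, ?_⟩
  · by_cases hi : i.1 ∈ U
    · simp [f, τ, hU i.1 hi j]
    · simp [f, τ, hi]
  have hgap : ∀ i ∈ U ×ˢ (Finset.univ : Finset Bool),
      b ^ q * v ≤ |moment q (f i) - moment q (f (τ i))| := by
    rintro ⟨k, β⟩ hi
    have hk : k ∈ U := (Finset.mem_product.1 hi).1
    have hzero : moment q (fun _ : Fin d → ℝ => (0 : ℝ)) = 0 := by simp [moment, hq]
    cases β <;> simpa [f, τ, hk, hzero] using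
      (hψ.le_moment_const_mul q hb k).trans (le_abs_self _)
  have hhalf : (1 / 2 : ℝ) ≤
      (U ×ˢ (Finset.univ : Finset Bool)).card / Fintype.card (ι × Bool) := by
    rw [Finset.card_product, Finset.card_univ, Fintype.card_prod, Nat.cast_mul, Nat.cast_mul,
      mul_div_mul_right _ _ (by simp), le_div_iff₀ (by simp [Fintype.card_pos])]
    linarith
  calc 2 * (b ^ q * v / 4) = 1 / 2 * (b ^ q * v) := by ring
    _ ≤ (U ×ˢ (Finset.univ : Finset Bool)).card / Fintype.card (ι × Bool) * (b ^ q * v) :=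
        mul_le_mul_of_nonneg_right hhalf (by positivity)
    _ ≤ _ := card_div_card_mul_le_expect (fun _ => abs_nonneg _) hgap

theorem moment_bumpSum_sub_moment_bumpSum_flipSigns [DecidableEq ι] (hψ : IsBumpFamily ψ v)
    (a b : ℝ) (U : Finset ι) (ε : ι → ℤˣ) :
    moment q (bumpSum ψ a fun k => b * (ε k : ℤ)) -
        moment q (bumpSum ψ a fun k => b * ((flipSigns U * ε) k : ℤ)) =
      rademacherSum (fun k =>
        moment q (fun x => a + b * ψ k x) - moment q (fun x => a + -b * ψ k x)) U ε := by
  rw [hψ.moment_bumpSum, hψ.moment_bumpSum, add_sub_add_left_eq_sub, ← Finset.sum_sub_distrib]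
  refine (Finset.sum_subset U.subset_univ fun k _ hk => ?_).symm.trans
    (Finset.sum_congr rfl fun k hk => ?_)
  · simp [flipSigns, hk]
  · rcases Int.units_eq_one_or (ε k) with h | h <;> simp [flipSigns, hk, h]

theorem le_minimaxError_of_signs (hψ : IsBumpFamily ψ v) (hv : 0 ≤ v)
    (hn : 2 * n ≤ Fintype.card ι) (hq : q ≠ 0) {a b : ℝ} (hb : 0 ≤ b) (hba : b ≤ a)
    (hF : ∀ ε : ι → ℤˣ, bumpSum ψ a (fun k => b * (ε k : ℤ)) ∈ F) :
    ENNReal.ofReal (2 * a ^ (q - 1) * b * v * √(Fintype.card ι / 2) / 16) ≤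
      minimaxError d n q F := by
  classical
  refine le_minimaxError_of_perm hF (fun ε => (hψ.continuous_bumpSum _ _).measurable) fun x => ?_
  obtain ⟨U, hU, hcard⟩ := exists_card_div_two_le_card_unseen hψ.disjoint hn x
  let D : ι → ℝ := fun k =>
    moment q (fun x => a + b * ψ k x) - moment q (fun x => a + -b * ψ k x)
  have hD : ∀ k, 2 * a ^ (q - 1) * b * v ≤ D k := hψ.le_moment_sub_moment hq hb hba
  refine ⟨Equiv.mulLeft (flipSigns U), fun ε j => ?_, ?_⟩
  · refine congrArg (a + ·) (Finset.sum_congr rfl fun k _ => ?_)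
    by_cases hk : k ∈ U
    · simp [hU k hk j]
    · simp [flipSigns, hk]
  set β := 2 * a ^ (q - 1) * b * v
  have hβ0 : 0 ≤ β := by
    have := hb.trans hba
    positivity
  calc 2 * (β * √(Fintype.card ι / 2) / 16) = √(β ^ 2 * (Fintype.card ι / 2)) / 8 := by
        rw [Real.sqrt_mul (sq_nonneg β), Real.sqrt_sq hβ0]
        ring
    _ ≤ √(∑ k ∈ U, D k ^ 2) / 8 := by
        gcongr
        calc β ^ 2 * (Fintype.card ι / 2) ≤ U.card • β ^ 2 := by
              rw [nsmul_eq_mul, mul_comm]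
              gcongr
          _ ≤ ∑ k ∈ U, D k ^ 2 :=
              Finset.card_nsmul_le_sum _ _ _ fun k _ => pow_le_pow_left₀ hβ0 (hD k) 2
    _ ≤ 𝔼 ε, |rademacherSum D U ε| := sqrt_sum_sq_le_expect_abs_rademacherSum D U
    _ = _ := Finset.expect_congr rfl fun ε _ =>
        congrArg abs (hψ.moment_bumpSum_sub_moment_bumpSum_flipSigns a b U ε).symm

end IsBumpFamily

end BumpFamily

section SmoothFunctions

variable {d : ℕ} {f φ : (Fin d → ℝ) → ℝ}

/-- The iterated partial derivative along a list of directions; the head of the list acts last. -/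
noncomputable def iteratedPartialDeriv (l : List (Fin d)) (f : (Fin d → ℝ) → ℝ) : (Fin d → ℝ) → ℝ :=
  l.foldr partialDeriv f

/-- The list of directions in which `D^α` differentiates: each `i` occurs `α i` times. -/
def directions (α : Fin d → ℕ) : List (Fin d) :=
  (List.finRange d).flatMap fun i => List.replicate (α i) i

theorem length_directions (α : Fin d → ℕ) : (directions α).length = ∑ i, α i := by
  simp [directions, List.length_flatMap, Fin.sum_univ_def]

theorem multiDeriv_eq_iteratedPartialDeriv (α : Fin d → ℕ) (f : (Fin d → ℝ) → ℝ) :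
    multiDeriv α f = iteratedPartialDeriv (directions α) f := by
  have hreplicate : ∀ (k : ℕ) (i : Fin d) (g : (Fin d → ℝ) → ℝ),
      (List.replicate k i).foldr partialDeriv g = (partialDeriv i)^[k] g := fun k i g => by
    induction k with
    | zero => rfl
    | succ k ih => rw [List.replicate_succ, List.foldr_cons, ih, Function.iterate_succ_apply']
  simp only [multiDeriv, iteratedPartialDeriv, directions, List.foldr_flatMap, hreplicate]

theorem contDiff_partialDeriv (hf : ContDiff ℝ ∞ f) (i : Fin d) :
    ContDiff ℝ ∞ (partialDeriv i f) :=
  (hf.fderiv_right (m := ∞) (by simp)).clm_apply contDiff_const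

theorem contDiff_iteratedPartialDeriv (hf : ContDiff ℝ ∞ f) (l : List (Fin d)) :
    ContDiff ℝ ∞ (iteratedPartialDeriv l f) := by
  induction l with
  | nil => exact hf
  | cons i l ih => exact contDiff_partialDeriv ih i

theorem partialDeriv_comm (hf : ContDiff ℝ ∞ f) (i j : Fin d) :
    partialDeriv i (partialDeriv j f) = partialDeriv j (partialDeriv i f) := by
  have hsnd : ∀ (i j : Fin d) (x : Fin d → ℝ), partialDeriv i (partialDeriv j f) x =
      fderiv ℝ (fderiv ℝ f) x (Pi.single i 1) (Pi.single j 1) := fun i j x => by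
    have hdiff : DifferentiableAt ℝ (fderiv ℝ f) x :=
      (hf.fderiv_right (m := ∞) (by simp)).differentiable (by simp) x
    change fderiv ℝ (fun y => fderiv ℝ f y (Pi.single j 1)) x (Pi.single i 1) = _
    simp [fderiv_clm_apply hdiff (differentiableAt_const _)]
  funext x
  rw [hsnd, hsnd]
  exact (contDiff_infty.1 hf 2).contDiffAt.isSymmSndFDerivAt (by simp) _ _

theorem iteratedPartialDeriv_partialDeriv (hf : ContDiff ℝ ∞ f) (i : Fin d) (l : List (Fin d)) :
    iteratedPartialDeriv l (partialDeriv i f) = partialDeriv i (iteratedPartialDeriv l f) := by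
  induction l with
  | nil => rfl
  | cons j l ih =>
    exact (congrArg (partialDeriv j) ih).trans
      (partialDeriv_comm (contDiff_iteratedPartialDeriv hf l) j i)

theorem tsupport_iteratedPartialDeriv_subset (l : List (Fin d)) :
    tsupport (iteratedPartialDeriv l f) ⊆ tsupport f := by
  induction l with
  | nil => exact subset_rfl
  | cons i l ih => exact (tsupport_fderiv_apply_subset ℝ _).trans ih

theorem integral_mul_partialDeriv (hf : ContDiff ℝ ∞ f) (hφ : ContDiff ℝ ∞ φ)
    (hc : HasCompactSupport φ) (i : Fin d) :
    ∫ x, f x * partialDeriv i φ x = -∫ x, partialDeriv i f x * φ x := by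
  have hc' : HasCompactSupport (partialDeriv i φ) := hc.fderiv_apply ℝ _
  refine integral_mul_fderiv_eq_neg_fderiv_mul_of_integrable ?_ ?_ ?_
    (fun x _ => hf.differentiable (by simp) x) (fun x _ => hφ.differentiable (by simp) x)
  · exact ((contDiff_partialDeriv hf i).continuous.mul
      hφ.continuous).integrable_of_hasCompactSupport hc.mul_left
  · exact (hf.continuous.mul
      (contDiff_partialDeriv hφ i).continuous).integrable_of_hasCompactSupport hc'.mul_left
  · exact (hf.continuous.mul hφ.continuous).integrable_of_hasCompactSupport hc.mul_left

theorem integral_mul_iteratedPartialDeriv (hf : ContDiff ℝ ∞ f) (hφ : ContDiff ℝ ∞ φ)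
    (hc : HasCompactSupport φ) (l : List (Fin d)) :
    ∫ x, f x * iteratedPartialDeriv l φ x =
      (-1) ^ l.length * ∫ x, iteratedPartialDeriv l f x * φ x := by
  induction l generalizing f with
  | nil => simp [iteratedPartialDeriv]
  | cons i l ih =>
    have hc' : HasCompactSupport (iteratedPartialDeriv l φ) :=
      hc.of_isClosed_subset (isClosed_tsupport _) (tsupport_iteratedPartialDeriv_subset l)
    calc ∫ x, f x * partialDeriv i (iteratedPartialDeriv l φ) x
        = -∫ x, partialDeriv i f x * iteratedPartialDeriv l φ x :=
          integral_mul_partialDeriv hf (contDiff_iteratedPartialDeriv hφ l) hc' i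
      _ = -((-1) ^ l.length * ∫ x, partialDeriv i (iteratedPartialDeriv l f) x * φ x) := by
          rw [ih (contDiff_partialDeriv hf i), iteratedPartialDeriv_partialDeriv hf]
      _ = _ := by rw [List.length_cons, pow_succ, mul_neg_one, neg_mul]; rfl

theorem contDiff_multiDeriv (hf : ContDiff ℝ ∞ f) (α : Fin d → ℕ) :
    ContDiff ℝ ∞ (multiDeriv α f) := by
  rw [multiDeriv_eq_iteratedPartialDeriv]
  exact contDiff_iteratedPartialDeriv hf _

theorem isWeakDeriv_multiDeriv (hf : ContDiff ℝ ∞ f) (α : Fin d → ℕ) :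
    IsWeakDeriv α f (multiDeriv α f) := by
  refine ⟨hf.continuous.locallyIntegrable.locallyIntegrableOn _,
    (contDiff_multiDeriv hf α).continuous.locallyIntegrable.locallyIntegrableOn _,
    fun φ hφ hc hs => ?_⟩
  have hout : ∀ g : (Fin d → ℝ) → ℝ, tsupport g ⊆ tsupport φ → ∀ x ∉ unitCube d, g x = 0 :=
    fun g hg x hx => image_eq_zero_of_notMem_tsupport fun h => hx (interior_subset (hs (hg h)))
  rw [multiDeriv_eq_iteratedPartialDeriv, multiDeriv_eq_iteratedPartialDeriv,
    setIntegral_eq_integral_of_forall_compl_eq_zero fun x hx => by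
      rw [hout _ (tsupport_iteratedPartialDeriv_subset _) x hx, mul_zero],
    setIntegral_eq_integral_of_forall_compl_eq_zero fun x hx => by
      rw [hout φ subset_rfl x hx, mul_zero],
    integral_mul_iteratedPartialDeriv hf hφ hc, length_directions]

theorem norm_iteratedFDeriv_iteratedPartialDeriv_le (hf : ContDiff ℝ ∞ f) (l : List (Fin d))
    (n : ℕ) (x : Fin d → ℝ) :
    ‖iteratedFDeriv ℝ n (iteratedPartialDeriv l f) x‖ ≤
      ‖iteratedFDeriv ℝ (n + l.length) f x‖ := by
  induction l generalizing n with
  | nil => rfl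
  | cons i l ih =>
    set g := iteratedPartialDeriv l f
    have hg' : ContDiff ℝ ∞ (fderiv ℝ g) :=
      (contDiff_iteratedPartialDeriv hf l).fderiv_right (by simp)
    calc ‖iteratedFDeriv ℝ n (partialDeriv i g) x‖
        ≤ ‖(Pi.single i 1 : Fin d → ℝ)‖ * ‖iteratedFDeriv ℝ n (fderiv ℝ g) x‖ :=
          norm_iteratedFDeriv_clm_apply_const hg'.contDiffAt (mod_cast le_top)
      _ = ‖iteratedFDeriv ℝ (n + 1) g x‖ := by
          rw [Pi.norm_single, norm_one, one_mul, norm_iteratedFDeriv_fderiv]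
      _ ≤ ‖iteratedFDeriv ℝ (n + (i :: l).length) f x‖ := by
          rw [List.length_cons, add_comm l.length, ← add_assoc]
          exact ih (n + 1)

theorem norm_multiDeriv_le (hf : ContDiff ℝ ∞ f) (α : Fin d → ℕ) (x : Fin d → ℝ) :
    ‖multiDeriv α f x‖ ≤ ‖iteratedFDeriv ℝ (∑ i, α i) f x‖ := by
  have h := norm_iteratedFDeriv_iteratedPartialDeriv_le hf (directions α) 0 x
  rwa [norm_iteratedFDeriv_zero, zero_add, length_directions,
    ← multiDeriv_eq_iteratedPartialDeriv] at h

theorem memLp_uniformCube (hf : Continuous f) (p : ℝ≥0∞) : MemLp f p (uniformCube d) := by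
  obtain ⟨C, hC⟩ := (isCompact_Icc : IsCompact (unitCube d)).exists_bound_of_continuousOn
    hf.continuousOn
  exact .of_bound hf.aestronglyMeasurable C
    ((ae_restrict_iff' measurableSet_Icc).2 (.of_forall hC))

theorem memSobolev_of_contDiff (hf : ContDiff ℝ ∞ f) (s : ℕ) (p : ℝ≥0∞) : MemSobolev s p f :=
  ⟨memLp_uniformCube hf.continuous p, fun α _ => ⟨multiDeriv α f, isWeakDeriv_multiDeriv hf α,
    memLp_uniformCube (contDiff_multiDeriv hf α).continuous p⟩⟩

theorem weakDerivNorm_le (hf : ContDiff ℝ ∞ f) (α : Fin d → ℕ) (p : ℝ≥0∞) :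
    weakDerivNorm α p f ≤ eLpNorm (iteratedFDeriv ℝ (∑ i, α i) f) p (uniformCube d) :=
  (iInf₂_le _ (isWeakDeriv_multiDeriv hf α)).trans (eLpNorm_mono (norm_multiDeriv_le hf α))

theorem mem_sobolevBall_of_eLpNorm_iteratedFDeriv_le {s : ℕ} {p R B : ℝ≥0∞}
    (hf : ContDiff ℝ ∞ f) (hB : ∀ j ≤ s, eLpNorm (iteratedFDeriv ℝ j f) p (uniformCube d) ≤ B)
    (hR : (multiIndices d s).card * B ≤ R) : f ∈ sobolevBall d s p R := by
  refine ⟨memSobolev_of_contDiff hf s p, le_trans ?_ hR⟩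
  rw [← nsmul_eq_mul]
  exact Finset.sum_le_card_nsmul _ _ _ fun α hα =>
    (weakDerivNorm_le hf α p).trans (hB _ (mem_multiIndices.1 hα))

end SmoothFunctions

section GridBumps

variable {d m : ℕ}

/-- A smooth bump on the cube `[-1/2, 1/2]^d`: supported in `[-1/3, 1/3]^d` and equal to one on
`[-1/4, 1/4]^d`. -/
noncomputable def cubeBump (d : ℕ) : ContDiffBump (0 : Fin d → ℝ) :=
  ⟨1 / 4, 1 / 3, by norm_num, by norm_num⟩

/-- The centre of the cell with index `k` in the division of the unit cube into `m ^ d` equal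
cells. -/
noncomputable def cellCenter (k : Fin d → Fin m) (i : Fin d) : ℝ := ((k i : ℝ) + 1 / 2) / m

/-- The bump `cubeBump d` rescaled to the cell with index `k`. -/
noncomputable def cellBump (k : Fin d → Fin m) (x : Fin d → ℝ) : ℝ :=
  cubeBump d ((m : ℝ) • (x - cellCenter k))

theorem contDiff_cellBump (k : Fin d → Fin m) : ContDiff ℝ ∞ (cellBump k) :=
  (cubeBump d).contDiff.comp ((contDiff_const_smul _).comp (contDiff_id.sub contDiff_const))

theorem norm_iteratedFDeriv_cellBump (k : Fin d → Fin m) (j : ℕ) (x : Fin d → ℝ) :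
    ‖iteratedFDeriv ℝ j (cellBump k) x‖ =
      m ^ j * ‖iteratedFDeriv ℝ j (cubeBump d) ((m : ℝ) • (x - cellCenter k))‖ := by
  have hshift := iteratedFDeriv_comp_sub (𝕜 := ℝ) (f := fun z => cubeBump d ((m : ℝ) • z)) j
    (cellCenter k) x
  have hscale := iteratedFDeriv_comp_const_smul (i := j) (m : ℝ) (cubeBump d).contDiff
  rw [hscale] at hshift
  refine (congrArg norm hshift).trans ?_
  rw [norm_smul, norm_pow, Real.norm_natCast]

theorem exists_norm_iteratedFDeriv_cellBump_le (d s : ℕ) :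
    ∃ C : ℝ, ∀ (m : ℕ) [NeZero m] (k : Fin d → Fin m), ∀ j ≤ s, ∀ x,
      ‖iteratedFDeriv ℝ j (cellBump k) x‖ ≤ C * m ^ s := by
  have hbound : ∀ j, ∃ C, ∀ x, ‖iteratedFDeriv ℝ j (cubeBump d) x‖ ≤ C := fun j =>
    ((cubeBump d).hasCompactSupport.iteratedFDeriv j).exists_bound_of_continuous
      ((cubeBump d).contDiff.continuous_iteratedFDeriv (n := ∞) (mod_cast le_top))
  choose C hC using hbound
  have hC0 : ∀ j, 0 ≤ C j := fun j => (norm_nonneg _).trans (hC j 0)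
  refine ⟨∑ j ∈ Finset.range (s + 1), C j, fun m _ k j hj x => ?_⟩
  rw [norm_iteratedFDeriv_cellBump, mul_comm]
  have hm : (1 : ℝ) ≤ m := mod_cast NeZero.one_le
  exact mul_le_mul ((hC j _).trans (Finset.single_le_sum (fun j _ => hC0 j)
    (Finset.mem_range.2 (Nat.lt_succ_of_le hj)))) (pow_le_pow_right₀ hm hj) (by positivity)
    (Finset.sum_nonneg fun j _ => hC0 j)

theorem inv_le_dist_cellCenter {k l : Fin d → Fin m} (hkl : k ≠ l) :
    (m : ℝ)⁻¹ ≤ dist (cellCenter k) (cellCenter l) := by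
  obtain ⟨i, hi⟩ := Function.ne_iff.1 hkl
  refine le_trans ?_ (dist_le_pi_dist (cellCenter k) (cellCenter l) i)
  have hone : (1 : ℝ) ≤ |(k i : ℝ) - (l i : ℝ)| := by
    have : (1 : ℤ) ≤ |((k i : ℕ) : ℤ) - (l i : ℕ)| :=
      Int.one_le_abs (sub_ne_zero.2 (mod_cast Fin.val_ne_of_ne hi))
    exact_mod_cast this
  rw [Real.dist_eq, cellCenter, cellCenter, ← sub_div, add_sub_add_right_eq_sub, abs_div,
    Nat.abs_cast, inv_eq_one_div]
  gcongr

variable [NeZero m]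

theorem tsupport_cellBump_subset (k : Fin d → Fin m) :
    tsupport (cellBump k) ⊆ Metric.closedBall (cellCenter k) (1 / 3 / m) := by
  have hm : (0 : ℝ) < m := Nat.cast_pos.2 (NeZero.pos m)
  refine closure_minimal (fun x hx => ?_) Metric.isClosed_closedBall
  have hx' : (m : ℝ) • (x - cellCenter k) ∈ tsupport (cubeBump d) := subset_tsupport _ hx
  rw [(cubeBump d).tsupport_eq, mem_closedBall_zero_iff, norm_smul, Real.norm_natCast] at hx'
  rwa [mem_closedBall_iff_norm, le_div_iff₀' hm]

theorem cellBump_eq_one {k : Fin d → Fin m} {x : Fin d → ℝ}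
    (hx : x ∈ Metric.closedBall (cellCenter k) (1 / 4 / m)) : cellBump k x = 1 := by
  have hm : (0 : ℝ) < m := Nat.cast_pos.2 (NeZero.pos m)
  refine (cubeBump d).one_of_mem_closedBall ?_
  rw [mem_closedBall_zero_iff, norm_smul, Real.norm_natCast]
  rwa [mem_closedBall_iff_norm, le_div_iff₀' hm] at hx

theorem pairwise_disjoint_tsupport_cellBump :
    Pairwise (Disjoint on fun k : Fin d → Fin m => tsupport (cellBump k)) := fun k l hkl => by
  have hm : (0 : ℝ) < m := Nat.cast_pos.2 (NeZero.pos m)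
  refine (Metric.closedBall_disjoint_closedBall ?_).mono
    (tsupport_cellBump_subset k) (tsupport_cellBump_subset l)
  refine lt_of_lt_of_le ?_ (inv_le_dist_cellCenter hkl)
  rw [← add_div, inv_eq_one_div]
  gcongr
  norm_num

theorem closedBall_cellCenter_subset_unitCube (k : Fin d → Fin m) {r : ℝ} (hr : r ≤ 1 / 2) :
    Metric.closedBall (cellCenter k) (r / m) ⊆ unitCube d := fun x hx => by
  have hm : (0 : ℝ) < m := Nat.cast_pos.2 (NeZero.pos m)
  have hcoord : ∀ i, |x i * m - ((k i : ℝ) + 1 / 2)| ≤ r := fun i => by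
    have h := (dist_le_pi_dist x _ i).trans hx
    rwa [Real.dist_eq, le_div_iff₀ hm, ← Nat.abs_cast m, ← abs_mul, sub_mul,
      cellCenter, div_mul_cancel₀ _ hm.ne'] at h
  have hk : ∀ i, (k i : ℝ) + 1 ≤ m := fun i => mod_cast (k i).2
  refine ⟨fun i => ?_, fun i => ?_⟩
  · refine nonneg_of_mul_nonneg_left ?_ hm
    linarith [(abs_le.1 (hcoord i)).1, (k i : ℕ).cast_nonneg (α := ℝ)]
  · refine le_of_mul_le_mul_right ?_ hm
    rw [Pi.one_apply, one_mul]
    linarith [(abs_le.1 (hcoord i)).2, hk i]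

theorem uniformCube_closedBall_cellCenter (k : Fin d → Fin m) {r : ℝ} (hr₀ : 0 ≤ r)
    (hr : r ≤ 1 / 2) :
    uniformCube d (Metric.closedBall (cellCenter k) (r / m)) =
      ENNReal.ofReal ((2 * r) ^ d / (m : ℝ) ^ d) := by
  rw [uniformCube, Measure.restrict_eq_self _ (closedBall_cellCenter_subset_unitCube k hr),
    Real.volume_pi_closedBall _ (by positivity), Fintype.card_fin, ← mul_div_assoc, div_pow]

theorem isBumpFamily_cellBump :
    IsBumpFamily (cellBump : (Fin d → Fin m) → (Fin d → ℝ) → ℝ) (1 / 2 ^ d / (m : ℝ) ^ d) where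
  continuous k := (contDiff_cellBump k).continuous
  nonneg _ _ := (cubeBump d).nonneg
  le_one _ _ := (cubeBump d).le_one
  disjoint := pairwise_disjoint_tsupport_cellBump.mono fun _ _ h =>
    h.mono (subset_tsupport _) (subset_tsupport _)
  le_measure k := by
    refine le_trans (le_of_eq ?_) (measureReal_mono fun x hx => cellBump_eq_one (k := k) hx)
    rw [measureReal_def, uniformCube_closedBall_cellCenter k (by norm_num) (by norm_num),
      ENNReal.toReal_ofReal (by positivity), ← one_div_pow]
    norm_num

end GridBumps

section SobolevMembership

theorem norm_iteratedFDeriv_bumpSum_le {ι : Type*} [Fintype ι] [Nonempty ι] {d j : ℕ}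
    {ψ : ι → (Fin d → ℝ) → ℝ} (hψ : ∀ k, ContDiff ℝ ∞ (ψ k))
    (hdisj : Pairwise (Disjoint on fun k => tsupport (ψ k))) {a B : ℝ} {θ : ι → ℝ}
    {x : Fin d → ℝ} (hB : ∀ k, |θ k| * ‖iteratedFDeriv ℝ j (ψ k) x‖ ≤ B) :
    ‖iteratedFDeriv ℝ j (bumpSum ψ a θ) x‖ ≤ |a| + B := by
  have hsmooth : ∀ k, ContDiff ℝ j (ψ k) := fun k => (hψ k).of_le (mod_cast le_top)
  have hconst : ‖iteratedFDeriv ℝ j (fun _ : Fin d → ℝ => a) x‖ ≤ |a| := by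
    rcases eq_or_ne j 0 with rfl | hj
    · rw [norm_iteratedFDeriv_zero, Real.norm_eq_abs]
    · simp [iteratedFDeriv_const_of_ne hj]
  obtain ⟨k, hk⟩ := exists_forall_ne_eq_zero (ψ := fun k => iteratedFDeriv ℝ j (ψ k))
    (hdisj.mono fun _ _ h => h.mono (support_iteratedFDeriv_subset j)
      (support_iteratedFDeriv_subset j)) x
  have hderiv : iteratedFDeriv ℝ j (bumpSum ψ a θ) x =
      iteratedFDeriv ℝ j (fun _ => a) x + θ k • iteratedFDeriv ℝ j (ψ k) x := by
    change iteratedFDeriv ℝ j (fun y => a + ∑ k, θ k • ψ k y) x = _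
    rw [fun_iteratedFDeriv_add_apply contDiffAt_const
        (ContDiff.sum fun k _ => (hsmooth k).const_smul (θ k)).contDiffAt,
      iteratedFDeriv_fun_sum_apply fun k _ => ((hsmooth k).const_smul (θ k)).contDiffAt]
    congr 1
    simp only [iteratedFDeriv_const_smul_apply' (hsmooth _).contDiffAt]
    exact Fintype.sum_eq_single k fun l hl => by rw [hk l hl, smul_zero]
  calc ‖iteratedFDeriv ℝ j (bumpSum ψ a θ) x‖
      ≤ ‖iteratedFDeriv ℝ j (fun _ : Fin d → ℝ => a) x‖ + ‖θ k • iteratedFDeriv ℝ j (ψ k) x‖ := by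
        rw [hderiv]
        exact norm_add_le _ _
    _ ≤ |a| + B := by
        rw [norm_smul]
        exact add_le_add hconst (hB k)

theorem eLpNorm_le_of_support_subset {X E : Type*} [MeasurableSpace X] [NormedAddCommGroup E]
    {μ : Measure X} {p : ℝ≥0∞} {f : X → E} {S : Set X} {C : ℝ} (hS : Function.support f ⊆ S)
    (hC : ∀ x, ‖f x‖ ≤ C) : eLpNorm f p μ ≤ μ S ^ p.toReal⁻¹ * ENNReal.ofReal C := by
  rw [← eLpNorm_restrict_eq_of_support_subset hS]
  exact (eLpNorm_le_of_ae_bound (.of_forall hC)).trans (by simp)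

theorem exists_pos_mul_ofReal_mul_le {R : ℝ≥0∞} (hR : 0 < R) (N : ℕ) (C : ℝ) :
    ∃ a : ℝ, 0 < a ∧ N * ENNReal.ofReal (a * C) ≤ R := by
  obtain ⟨a, ha, haR⟩ := ENNReal.exists_nnreal_pos_mul_lt
    (ENNReal.mul_ne_top (ENNReal.natCast_ne_top N) (ENNReal.ofReal_ne_top (r := C))) hR.ne'
  refine ⟨a, ha, le_trans (le_of_eq ?_) haR.le⟩
  rw [ENNReal.ofReal_mul NNReal.zero_le_coe, ENNReal.ofReal_coe_nnreal, mul_left_comm]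

theorem exists_bumpSum_cellBump_mem_sobolevBall (d s : ℕ) (p : ℝ≥0∞) {R : ℝ≥0∞} (hR : 0 < R) :
    ∃ a : ℝ, 0 < a ∧ ∀ (m : ℕ) [NeZero m] (θ : (Fin d → Fin m) → ℝ),
      (∀ k, |θ k| ≤ a / m ^ s) → bumpSum cellBump a θ ∈ sobolevBall d s p R := by
  obtain ⟨C, hC⟩ := exists_norm_iteratedFDeriv_cellBump_le d s
  obtain ⟨a, ha, haR⟩ := exists_pos_mul_ofReal_mul_le hR (multiIndices d s).card (1 + C)
  refine ⟨a, ha, fun m _ θ hθ => mem_sobolevBall_of_eLpNorm_iteratedFDeriv_le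
    (contDiff_const.add (ContDiff.sum fun k _ => contDiff_const.mul (contDiff_cellBump k)))
    (fun j hj => ?_) haR⟩
  have hm : (0 : ℝ) < m := Nat.cast_pos.2 (NeZero.pos m)
  have hbound : ∀ x, ‖iteratedFDeriv ℝ j (bumpSum cellBump a θ) x‖ ≤ a * (1 + C) := fun x =>
    calc _ ≤ |a| + a * C := norm_iteratedFDeriv_bumpSum_le contDiff_cellBump
            pairwise_disjoint_tsupport_cellBump fun k => by
          calc |θ k| * ‖iteratedFDeriv ℝ j (cellBump k) x‖ ≤ a / m ^ s * (C * m ^ s) :=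
                mul_le_mul (hθ k) (hC m k j hj x) (norm_nonneg _) (by positivity)
            _ = a * C := by field_simp
      _ = a * (1 + C) := by rw [abs_of_pos ha, mul_add, mul_one]
  simpa using eLpNorm_le_of_ae_bound (p := p) (μ := uniformCube d) (.of_forall hbound)

theorem exists_smul_cellBump_mem_sobolevBall (d s : ℕ) (p : ℝ≥0∞) {R : ℝ≥0∞} (hR : 0 < R) :
    ∃ a : ℝ, 0 < a ∧ ∀ (m : ℕ) [NeZero m] (k : Fin d → Fin m) (t : ℝ),
      |t| ≤ a / m ^ s * ((m : ℝ) ^ d) ^ p⁻¹.toReal →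
        (fun x => t * cellBump k x) ∈ sobolevBall d s p R := by
  obtain ⟨C, hC⟩ := exists_norm_iteratedFDeriv_cellBump_le d s
  obtain ⟨a, ha, haR⟩ := exists_pos_mul_ofReal_mul_le hR (multiIndices d s).card C
  refine ⟨a, ha, fun m _ k t ht => mem_sobolevBall_of_eLpNorm_iteratedFDeriv_le
    (contDiff_const.mul (contDiff_cellBump k)) (fun j hj => ?_) haR⟩
  have hm : (0 : ℝ) < m := Nat.cast_pos.2 (NeZero.pos m)
  set S := Metric.closedBall (cellCenter k) (1 / 2 / m)
  have hsupp : Function.support (iteratedFDeriv ℝ j fun x => t * cellBump k x) ⊆ S :=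
    calc _ ⊆ tsupport fun x => t * cellBump k x := support_iteratedFDeriv_subset j
      _ ⊆ tsupport (cellBump k) := tsupport_mul_subset_right
      _ ⊆ Metric.closedBall (cellCenter k) (1 / 3 / m) := tsupport_cellBump_subset k
      _ ⊆ S := Metric.closedBall_subset_closedBall (by gcongr; norm_num)
  have hbound : ∀ x, ‖iteratedFDeriv ℝ j (fun x => t * cellBump k x) x‖ ≤
      ((m : ℝ) ^ d) ^ p⁻¹.toReal * (a * C) := fun x => by
    change ‖iteratedFDeriv ℝ j (fun x => t • cellBump k x) x‖ ≤ _
    rw [iteratedFDeriv_const_smul_apply'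
      ((contDiff_cellBump k).of_le (mod_cast le_top)).contDiffAt, norm_smul, Real.norm_eq_abs]
    calc |t| * ‖iteratedFDeriv ℝ j (cellBump k) x‖
        ≤ a / m ^ s * ((m : ℝ) ^ d) ^ p⁻¹.toReal * (C * m ^ s) :=
          mul_le_mul ht (hC m k j hj x) (norm_nonneg _) (by positivity)
      _ = ((m : ℝ) ^ d) ^ p⁻¹.toReal * (a * C) := by field_simp
  have hvol : uniformCube d S ^ p.toReal⁻¹ =
      ENNReal.ofReal (((m : ℝ) ^ d) ^ p⁻¹.toReal)⁻¹ := by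
    rw [uniformCube_closedBall_cellCenter k (by norm_num) le_rfl, ← ENNReal.toReal_inv,
      ENNReal.ofReal_rpow_of_pos (by positivity), ← Real.inv_rpow (by positivity)]
    norm_num
  calc _ ≤ uniformCube d S ^ p.toReal⁻¹ *
          ENNReal.ofReal (((m : ℝ) ^ d) ^ p⁻¹.toReal * (a * C)) :=
        eLpNorm_le_of_support_subset hsupp hbound
    _ = ENNReal.ofReal (a * C) := by
        rw [hvol, ← ENNReal.ofReal_mul (by positivity), inv_mul_cancel_left₀ (by positivity)]

end SobolevMembership

section Rates

variable {d q : ℕ}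

theorem exists_grid (hd : d ≠ 0) {n : ℕ} (hn : n ≠ 0) :
    ∃ m : ℕ, m ≠ 0 ∧ 2 * n ≤ m ^ d ∧ m ^ d ≤ 2 ^ (d + 1) * n := by
  have hex : ∃ m : ℕ, 2 * n ≤ (m + 1) ^ d :=
    ⟨2 * n, (Nat.le_succ _).trans (Nat.le_self_pow hd _)⟩
  obtain ⟨m, hm, hmin⟩ : ∃ m : ℕ, 2 * n ≤ (m + 1) ^ d ∧ ∀ j < m, (j + 1) ^ d < 2 * n := by
    classical
    exact ⟨Nat.find hex, Nat.find_spec hex, fun j hj => not_le.1 (Nat.find_min hex hj)⟩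
  refine ⟨m + 1, m.succ_ne_zero, hm, ?_⟩
  cases m with
  | zero =>
    rw [zero_add, one_pow]
    exact Nat.one_le_iff_ne_zero.2 (by positivity)
  | succ j =>
    calc (j + 1 + 1) ^ d ≤ (2 * (j + 1)) ^ d := Nat.pow_le_pow_left (by omega) d
      _ = 2 ^ d * (j + 1) ^ d := mul_pow _ _ _
      _ ≤ 2 ^ d * (2 * n) := Nat.mul_le_mul_left _ (hmin j j.lt_succ_self).le
      _ = 2 ^ (d + 1) * n := by ring

theorem min_one_rpow_mul_rpow_le_rpow {x y K : ℝ} (hx : 0 < x) (hxy : x ≤ y) (hK : 0 ≤ K)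
    (hyK : y ≤ K * x) (E : ℝ) : min 1 (K ^ E) * x ^ E ≤ y ^ E := by
  rcases le_total 0 E with hE | hE
  · calc min 1 (K ^ E) * x ^ E ≤ 1 * x ^ E := by gcongr; exact min_le_left _ _
      _ ≤ y ^ E := by rw [one_mul]; gcongr
  · calc min 1 (K ^ E) * x ^ E ≤ K ^ E * x ^ E := by gcongr; exact min_le_right _ _
      _ = (K * x) ^ E := (Real.mul_rpow hK hx.le).symm
      _ ≤ y ^ E := Real.rpow_le_rpow_of_nonpos (hx.trans_le hxy) hyK hE

theorem exists_rpow_le_minimaxError_of_grid (hd : d ≠ 0) {F : Set ((Fin d → ℝ) → ℝ)} {c E : ℝ}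
    (hc : 0 < c) (h : ∀ n m : ℕ, [NeZero m] → 2 * n ≤ m ^ d →
      ENNReal.ofReal (c * ((m : ℝ) ^ d) ^ E) ≤ minimaxError d n q F) :
    ∃ c' : ℝ, 0 < c' ∧ ∀ n : ℕ, 1 ≤ n →
      ENNReal.ofReal (c' * (n : ℝ) ^ E) ≤ minimaxError d n q F := by
  refine ⟨c * min 1 ((2 ^ (d + 1)) ^ E), by positivity, fun n hn => ?_⟩
  obtain ⟨m, hm, hnm, hmn⟩ := exists_grid hd (Nat.one_le_iff_ne_zero.1 hn)
  have : NeZero m := ⟨hm⟩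
  refine le_trans (ENNReal.ofReal_le_ofReal ?_) (h n m hnm)
  rw [mul_assoc]
  gcongr
  refine min_one_rpow_mul_rpow_le_rpow (Nat.cast_pos.2 hn) ?_ (by positivity) (mod_cast hmn) E
  exact_mod_cast (Nat.le_mul_of_pos_left n two_pos).trans hnm

theorem pow_eq_pow_rpow_div (hd : d ≠ 0) {x : ℝ} (hx : 0 ≤ x) (s : ℕ) :
    x ^ s = (x ^ d) ^ ((s : ℝ) / d) := by
  rw [← Real.rpow_natCast_mul hx, mul_div_cancel₀ _ (Nat.cast_ne_zero.2 hd), Real.rpow_natCast]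

theorem exists_rpow_le_minimaxError_sobolevBall_of_spikes (hd : d ≠ 0) (hq : q ≠ 0) (s : ℕ)
    (p : ℝ≥0∞) {R : ℝ≥0∞} (hR : 0 < R) :
    ∃ c : ℝ, 0 < c ∧ ∀ n : ℕ, 1 ≤ n →
      ENNReal.ofReal (c * (n : ℝ) ^ (-(q : ℝ) * ((s : ℝ) / d - p⁻¹.toReal) - 1)) ≤
        minimaxError d n q (sobolevBall d s p R) := by
  obtain ⟨a, ha, hmem⟩ := exists_smul_cellBump_mem_sobolevBall d s p hR
  refine exists_rpow_le_minimaxError_of_grid hd (c := a ^ q / 2 ^ d / 4) (by positivity)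
    fun n m _ hnm => ?_
  have hm : (0 : ℝ) < m := Nat.cast_pos.2 (NeZero.pos m)
  set b := a / m ^ s * ((m : ℝ) ^ d) ^ p⁻¹.toReal with hb
  refine le_trans (ENNReal.ofReal_le_ofReal (le_of_eq ?_))
    (isBumpFamily_cellBump.le_minimaxError_of_spikes (b := b) (by positivity) (by simpa using hnm)
      hq (by positivity) fun k t ht => hmem m k t (by rw [abs_of_nonneg ht.1]; exact ht.2))
  rw [hb, pow_eq_pow_rpow_div hd hm.le s]
  set X := (m : ℝ) ^ d
  have hX : 0 < X := by positivity
  have hpow : X ^ (-(q : ℝ) * ((s : ℝ) / d - p⁻¹.toReal) - 1) =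
      ((X ^ ((s : ℝ) / d))⁻¹ * X ^ p⁻¹.toReal) ^ q * X⁻¹ := by
    rw [← Real.rpow_neg hX.le, ← Real.rpow_add hX, ← Real.rpow_mul_natCast hX.le,
      ← Real.rpow_neg_one X, ← Real.rpow_add hX]
    ring_nf
  rw [hpow, mul_pow, mul_pow, div_pow]
  ring

theorem exists_rpow_le_minimaxError_sobolevBall_of_signs (hd : d ≠ 0) (hq : q ≠ 0) (s : ℕ)
    (p : ℝ≥0∞) {R : ℝ≥0∞} (hR : 0 < R) :
    ∃ c : ℝ, 0 < c ∧ ∀ n : ℕ, 1 ≤ n →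
      ENNReal.ofReal (c * (n : ℝ) ^ (-1 / 2 - (s : ℝ) / d)) ≤
        minimaxError d n q (sobolevBall d s p R) := by
  obtain ⟨a, ha, hmem⟩ := exists_bumpSum_cellBump_mem_sobolevBall d s p hR
  refine exists_rpow_le_minimaxError_of_grid hd (c := a ^ q / 2 ^ d / √2 / 8) (by positivity)
    fun n m _ hnm => ?_
  have hm : (1 : ℝ) ≤ m := mod_cast NeZero.one_le
  refine le_trans (ENNReal.ofReal_le_ofReal (le_of_eq ?_))
    (isBumpFamily_cellBump.le_minimaxError_of_signs (a := a) (b := a / m ^ s) (by positivity)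
      (by simpa using hnm) hq (by positivity) (div_le_self ha.le (one_le_pow₀ hm))
      fun ε => hmem m _ fun k => ?_)
  · rw [pow_eq_pow_rpow_div hd (zero_le_one.trans hm) s, Fintype.card_fun, Fintype.card_fin,
      Fintype.card_fin, Nat.cast_pow]
    set X := (m : ℝ) ^ d
    have hX : 0 < X := by positivity
    have hpow : X ^ (-1 / 2 - (s : ℝ) / d) = (X ^ ((s : ℝ) / d))⁻¹ * X⁻¹ * √X := by
      rw [Real.sqrt_eq_rpow, ← Real.rpow_neg hX.le, ← Real.rpow_neg_one X, ← Real.rpow_add hX,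
        ← Real.rpow_add hX]
      ring_nf
    rw [hpow, Real.sqrt_div hX.le, ← pow_sub_one_mul hq a]
    ring
  · have hb : 0 ≤ a / (m : ℝ) ^ s := by positivity
    rcases Int.units_eq_one_or (ε k) with h | h <;> simp [h, abs_of_nonneg hb]

end Rates

theorem theorem2p1_general (d : ℕ) (hd : 0 < d) (s q : ℕ) (hq : q ≠ 0) (p : ℝ≥0∞) (_hp : p ≠ 0)
    (R : ℝ≥0∞) (hR : 0 < R) :
    ∃ c : ℝ, 0 < c ∧ ∀ n : ℕ, 1 ≤ n →
      ENNReal.ofReal (c * (n : ℝ) ^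
          max (-(q : ℝ) * ((s : ℝ) / (d : ℝ) - p⁻¹.toReal) - 1) (-1 / 2 - (s : ℝ) / (d : ℝ)))
        ≤ minimaxError d n q (sobolevBall d s p R) := by
  obtain ⟨c₁, hc₁, h₁⟩ := exists_rpow_le_minimaxError_sobolevBall_of_spikes hd.ne' hq s p hR
  obtain ⟨c₂, hc₂, h₂⟩ := exists_rpow_le_minimaxError_sobolevBall_of_signs hd.ne' hq s p hR
  refine ⟨min c₁ c₂, lt_min hc₁ hc₂, fun n hn => ?_⟩
  rcases max_choice (-(q : ℝ) * ((s : ℝ) / (d : ℝ) - p⁻¹.toReal) - 1)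
    (-1 / 2 - (s : ℝ) / (d : ℝ)) with h | h <;> rw [h]
  · refine le_trans (ENNReal.ofReal_le_ofReal ?_) (h₁ n hn)
    gcongr
    exact min_le_left _ _
  · refine le_trans (ENNReal.ofReal_le_ofReal ?_) (h₂ n hn)
    gcongr
    exact min_le_right _ _

theorem theorem2p1 (d : ℕ) (hd : 0 < d) (s q : ℕ) (p : ℝ) (hp : 2 < p)
    (hqp : (q : ℝ) < p) (hpq : p < 2 * (q : ℝ)) (R : ℝ≥0∞) (hR : 0 < R) :
    ∃ c : ℝ, 0 < c ∧ ∀ n : ℕ, 1 ≤ n →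
      ENNReal.ofReal (c * (n : ℝ) ^
          max (-(q : ℝ) * ((s : ℝ) / (d : ℝ) - 1 / p) - 1) (-1 / 2 - (s : ℝ) / (d : ℝ)))
        ≤ minimaxError d n q (sobolevBall d s (ENNReal.ofReal p) R) := by
  have hp₀ : 0 < p := two_pos.trans hp
  have hq : q ≠ 0 := by
    rintro rfl
    exact hp₀.not_gt (by simpa using hpq)
  simpa [ENNReal.toReal_ofReal hp₀.le] using
    theorem2p1_general d hd s q hq (ENNReal.ofReal p) (ENNReal.ofReal_pos.2 hp₀).ne' R hR
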